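/- **Setting.** Let $G=(V,E)$ be a finite directed graph with $n=|V|$ nodes and let $f$ be an integer with $n>f>0$. A node $u$ can send messages directly to a node $v$ if and only if $(u,v)\in E$. The system is asynchronous: every non-faulty node takes infinitely many steps, every message sent along an edge to a non-faulty node is received exactly once after an arbitrary finite delay, and messages may be reordered. The algorithm is deterministic and may depend on $G$. At most $f$ nodes are Byzantine faulty. Faulty nodes may collude and behave arbitrarily, but messages are authenticated by (ideal) digital signatures: no node can forge a signature of a non-faulty node, it can only pass on those signed messages that it, or a node colluding with it, has received. Every node $u$ has an input $x_u\in I$, where $I\subset\mathbb{R}$ is a fixed input set. For $\varepsilon>0$, an algorithm achieves *$\varepsilon$-approximate Byzantine consensus* on $G$ in the presence of up to $f$ Byzantine faulty nodes, with inputs in $I$, if in each of its executions, for all inputs in $I$ and every set of at most $f$ faulty nodes: * (termination) each non-faulty node eventually outputs a value; * (validity) the output of each non-faulty node lies in the convex hull of the inputs of the non-faulty nodes; * ($\varepsilon$-agreement) the outputs of any two non-faulty nodes differ by at most $\varepsilon$. The problem is *possible* on $G$ if some algorithm achieves it. For $F\subset V$ let $G_F$ be the subgraph of $G$ induced by $V\setminus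 F$. A *source component* of $G_F$ is a strongly connected component of $G_F$ that has no incoming edges from vertices of $G_F$ outside it. The graph $G$ satisfies *Condition A* if * for every $F\subset V$ with $|F|\le f$, the graph $G_F$ has a unique source component $S_F$, and $|S_F|\ge 2f+1$; and * for all $F,F'\subset V$ with $|F|,|F'|\le f$, $|S_F\cap S_{F'}|\ge f+1$. **Theorem.** In an asynchronous system with message authentication, with binary inputs ($I=\{0,1\}$), $\varepsilon$-approximate Byzantine consensus in the presence of up to $f$ Byzantine faulty nodes is possible on $G$ for every $\varepsilon>0$ if and only if $G$ satisfies Condition A. The same equivalence holds for real-valued inputs in any interval $I=[a,b]$ with $a<b$. -/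

import Mathlib

/-! ## Source components and Condition A -/

universe u

/-- One edge of the graph `G_F`, the subgraph of `G` induced by the vertices outside `F`. -/
def EdgeAvoiding {V : Type u} (G : Digraph V) (F : Finset V) (a b : V) : Prop :=
  a ∉ F ∧ b ∉ F ∧ G.Adj a b

/-- There is a (possibly trivial) directed path from `a` to `b` in `G_F`. -/
def ReachAvoiding {V : Type u} (G : Digraph V) (F : Finset V) (a b : V) : Prop :=
  Relation.ReflTransGen (EdgeAvoiding G F) a b

/-- `S` is a strongly connected component of `G_F`: a nonempty set of vertices of `G_F` that is
maximal subject to any two of its members having paths to each other in `G_F`. -/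
def IsStrongComponent {V : Type u} (G : Digraph V) (F S : Finset V) : Prop :=
  S.Nonempty ∧
    Maximal (fun T : Finset V =>
      (∀ v ∈ T, v ∉ F) ∧ ∀ a ∈ T, ∀ b ∈ T, ReachAvoiding G F a b) S

/-- `S` is a source component of `G_F`: a strongly connected component of `G_F` without incoming
edges from the vertices of `G_F` outside `S`. -/
def IsSourceComponent {V : Type u} (G : Digraph V) (F S : Finset V) : Prop :=
  IsStrongComponent G F S ∧ ∀ a b, a ∉ S → b ∈ S → ¬ EdgeAvoiding G F a b

/-- Condition A for the graph `G` and the fault bound `f`. -/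
structure ConditionA {V : Type u} [DecidableEq V] (G : Digraph V) (f : ℕ) : Prop where
  unique : ∀ F : Finset V, F.card ≤ f → ∃! S : Finset V, IsSourceComponent G F S
  size : ∀ F S : Finset V, F.card ≤ f → IsSourceComponent G F S → 2 * f + 1 ≤ S.card
  inter : ∀ F F' S S' : Finset V, F.card ≤ f → F'.card ≤ f →
    IsSourceComponent G F S → IsSourceComponent G F' S' → f + 1 ≤ (S ∩ S').card

/-! ## Messages with ideal digital signatures -/

/-- Messages: real numbers, node identifiers, pairs, and signed messages. `Msg.signed u m` is the
clear text `m` together with a signature of `m` under the private key of node `u`. -/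
inductive Msg (V : Type u) : Type u where
  | real (x : ℝ) : Msg V
  | node (v : V) : Msg V
  | pair (m₁ m₂ : Msg V) : Msg V
  | signed (u : V) (m : Msg V) : Msg V

/-- `Derivable K R m`: the message `m` can be produced by a party that holds the private keys of
the nodes in `K` and has received the messages in `R`. Clear text is freely readable and freely
composable; a new signature of `u` can be made only with the key of `u`. -/
inductive Derivable {V : Type u} (K : Set V) (R : Set (Msg V)) : Msg V → Prop where
  | received {m : Msg V} : m ∈ R → Derivable K R m
  | real (x : ℝ) : Derivable K R (Msg.real x)
  | node (v : V) : Derivable K R (Msg.node v)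
  | pair {m₁ m₂ : Msg V} : Derivable K R m₁ → Derivable K R m₂ → Derivable K R (Msg.pair m₁ m₂)
  | fst {m₁ m₂ : Msg V} : Derivable K R (Msg.pair m₁ m₂) → Derivable K R m₁
  | snd {m₁ m₂ : Msg V} : Derivable K R (Msg.pair m₁ m₂) → Derivable K R m₂
  | sign {u : V} {m : Msg V} : u ∈ K → Derivable K R m → Derivable K R (Msg.signed u m)
  | unsign {u : V} {m : Msg V} : Derivable K R (Msg.signed u m) → Derivable K R m

/-! ## Algorithms -/

/-- What a node observes in one of its steps: either no message (`none`), or one message together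
with the incoming neighbour whose link delivered it. -/
abbrev Obs (V : Type u) : Type u := Option (V × Msg V)

/-- The local view of a node: its observations in all its steps so far, the latest one first. -/
abbrev View (V : Type u) : Type u := List (Obs V)

/-- A deterministic algorithm for all nodes. In each step a node may send one message (which may
bundle several) to each outgoing neighbour, depending on its identity, its input and its view;
its output is a write-once function of the same data. A node can sign only with its own key. -/
structure Algorithm (V : Type u) where
  /-- `send v x h w` is the message that `v`, with input `x`, sends to `w` in the step after which
  its view is `h`. -/
  send : V → ℝ → View V → V → Option (Msg V)
  /-- `output v x h` is the output of `v`, if it has been chosen by the time its view is `h`. -/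
  output : V → ℝ → View V → Option ℝ
  authentic : ∀ (v : V) (x : ℝ) (h : View V) (w : V) (m : Msg V), send v x h w = some m →
    Derivable {v} {m' : Msg V | ∃ p : V, some (p, m') ∈ h} m
  write_once : ∀ (v : V) (x : ℝ) (h : View V) (o : Obs V) (y : ℝ),
    output v x h = some y → output v x (o :: h) = some y

/-! ## Asynchronous executions -/

/-- An infinite run of a message-passing system. In step `t` the node `actor t` receives at most
one message, namely the one that was sent to it in step `s` if `recv t = some s`, and then sends
the messages `sent t`, at most one to each node. -/
structure Run (V : Type u) where
  actor : ℕ → V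
  recv : ℕ → Option ℕ
  sent : ℕ → V → Option (Msg V)

/-- What the acting node observes in step `t`. -/
def Run.obs {V : Type u} (e : Run V) (t : ℕ) : Obs V :=
  (e.recv t).bind fun s => (e.sent s (e.actor t)).map fun m => (e.actor s, m)

/-- The view of node `v` just before step `t`. -/
def Run.view {V : Type u} [DecidableEq V] (e : Run V) (v : V) : ℕ → View V
  | 0 => []
  | t + 1 => if e.actor t = v then e.obs t :: e.view v t else e.view v t

/-- All messages received by nodes in `B` in the steps up to and including `t`. -/
def Run.receivedBy {V : Type u} (e : Run V) (B : Finset V) (t : ℕ) : Set (Msg V) :=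
  {m | ∃ s ≤ t, e.actor s ∈ B ∧ ∃ p : V, e.obs s = some (p, m)}

/-- `e` is an execution of algorithm `A` on the graph `G` with inputs `x`, in the asynchronous
model with message authentication, in which `B` is the set of Byzantine faulty nodes. -/
structure IsExecution {V : Type u} [DecidableEq V] (G : Digraph V) (A : Algorithm V) (x : V → ℝ)
    (B : Finset V) (e : Run V) : Prop where
  /-- Only messages that were sent earlier, along an edge of `G`, are received. -/
  integrity : ∀ t s, e.recv t = some s →
    s < t ∧ G.Adj (e.actor s) (e.actor t) ∧ ∃ m, e.sent s (e.actor t) = some m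
  /-- No message is received twice. -/
  no_duplication : ∀ t t' s, e.recv t = some s → e.recv t' = some s →
    e.actor t = e.actor t' → t = t'
  /-- Every message sent along an edge of `G` to a non-faulty node is eventually received (after
  an arbitrary finite delay, and not necessarily in the order of sending). -/
  reliable : ∀ s v m, v ∉ B → G.Adj (e.actor s) v → e.sent s v = some m →
    ∃ t, e.actor t = v ∧ e.recv t = some s
  /-- Every non-faulty node takes infinitely many steps. -/
  fair : ∀ v, v ∉ B → ∀ t, ∃ t', t ≤ t' ∧ e.actor t' = v
  /-- Non-faulty nodes follow the algorithm. -/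
  follows : ∀ t, e.actor t ∉ B →
    e.sent t = A.send (e.actor t) (x (e.actor t)) (e.view (e.actor t) (t + 1))
  /-- Faulty nodes may collude and send arbitrary messages, except that they cannot forge
  signatures of non-faulty nodes. -/
  unforgeable : ∀ t, e.actor t ∈ B → ∀ w m, e.sent t w = some m →
    Derivable (B : Set V) (e.receivedBy B t) m

/-! ## Approximate Byzantine consensus -/

/-- In the run `e` of `A` with inputs `x`, node `v` outputs `y` at some time. -/
def Outputs {V : Type u} [DecidableEq V] (A : Algorithm V) (x : V → ℝ) (e : Run V) (v : V)
    (y : ℝ) : Prop :=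
  ∃ t, A.output v (x v) (e.view v t) = some y

/-- `A` achieves `ε`-approximate Byzantine consensus on `G` in the presence of up to `f` Byzantine
faulty nodes, for all inputs in the set `I`. -/
structure SolvesApproxConsensus {V : Type u} [DecidableEq V] (G : Digraph V) (f : ℕ) (I : Set ℝ)
    (ε : ℝ) (A : Algorithm V) : Prop where
  termination : ∀ (x : V → ℝ) (B : Finset V) (e : Run V), (∀ v, x v ∈ I) → B.card ≤ f →
    IsExecution G A x B e → ∀ v, v ∉ B → ∃ y, Outputs A x e v y
  validity : ∀ (x : V → ℝ) (B : Finset V) (e : Run V), (∀ v, x v ∈ I) → B.card ≤ f →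
    IsExecution G A x B e → ∀ v, v ∉ B → ∀ y, Outputs A x e v y →
      y ∈ convexHull ℝ (x '' {w | w ∉ B})
  agreement : ∀ (x : V → ℝ) (B : Finset V) (e : Run V), (∀ v, x v ∈ I) → B.card ≤ f →
    IsExecution G A x B e → ∀ v w, v ∉ B → w ∉ B → ∀ y z, Outputs A x e v y →
      Outputs A x e w z → |y - z| ≤ ε

/-- `ε`-approximate Byzantine consensus on `G` with up to `f` Byzantine faulty nodes and inputs in
`I` is possible in an asynchronous system with message authentication. -/
def ApproxConsensusPossible {V : Type u} [DecidableEq V] (G : Digraph V) (f : ℕ) (I : Set ℝ)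
    (ε : ℝ) : Prop :=
  ∃ A : Algorithm V, SolvesApproxConsensus G f I ε A

/-!
Both equivalences follow from `approxConsensusPossible_iff`, which concerns any set of inputs that
lies in an interval `[a, b]` and contains `a` and `b`.

*Condition A suffices* (`blockAlgorithm_solves`). Call the source components `S_F` with `|F| ≤ f`
quorums. Nodes flood everything they know and issue signed blocks in levels. A block at level `0`
states an input. A block at level `k + 1` contains level `k` blocks of all nodes of a quorum and
states a value computed from theirs: a value surviving the removal of the `f` smallest and `f`
largest ones if `k = 0` (possible as quorums have at least `2f + 1` nodes), and the midpoint of the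
smallest and the largest one if `k > 0`. Since a block carries its own justification, a faulty node
can lie only about its input; from level `1` on, all values lie in the convex hull of the inputs of
the non-faulty nodes (`IsExecution.attested_mem_hull`). A faulty node can still issue several blocks
at the same level, but a non-faulty one does not (`IsExecution.accepted_unique`), and two quorums
share at least `f + 1` nodes, hence a non-faulty one. So any two blocks of level `k + 2`, whoever
signed them, use a common value of level `k + 1`, and the midpoint rule halves the diameter of the
set of possible values (`IsExecution.attested_dist`). No level blocks forever, because with faulty
set `B` the blocks of the quorum `S_B` reach all non-faulty nodes (`IsExecution.exists_accepted`).

*Condition A is necessary* (`conditionA_of_solves`). Let `S` be a set that receives edges from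
outside only from a set `F` of at most `f` nodes. If `F` is silent, the nodes of `S` have to decide
on their own. For two such sets `S`, `S'` with at most `f` common nodes, the common nodes can be
faulty and behave towards `S` as if all inputs were `a` and towards `S'` as if all were `b`, while
all messages into `S` and `S'` from outside are delayed; this contradicts agreement
(`SolvesApproxConsensus.card_inter`), provided that neither set contains the other. A set `S` of at
most `f` nodes is excluded likewise, with the complement of `S` as `S'`. If `S` has at most `2f`
nodes, split it into two parts of at most `f` nodes with inputs `a` and `b`; each part has to output
its own input, as the other part may be faulty and the nodes outside `S` slow
(`SolvesApproxConsensus.not_split`). The executions needed are provided by `exists_simulation`. All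
runs compared there use one fixed schedule, which proposes every delivery infinitely often, so that
views in different runs can be compared step by step.
-/

/-! ### Source components -/

/-- `S` lies in `G_F` and receives no edge of `G_F` from outside: all messages that reach `S` come
from `S` itself or from `F`. -/
def InClosed {V : Type u} (G : Digraph V) (F S : Finset V) : Prop :=
  (∀ v ∈ S, v ∉ F) ∧ ∀ a b, G.Adj a b → b ∈ S → a ∉ S → a ∈ F

lemma IsSourceComponent.inClosed {V : Type u} {G : Digraph V} {F S : Finset V}
    (h : IsSourceComponent G F S) : InClosed G F S := by
  refine ⟨h.1.2.1.1, fun a b hab hb ha => ?_⟩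
  by_contra haF
  exact h.2 a b ha hb ⟨haF, h.1.2.1.1 b hb, hab⟩

lemma IsStrongComponent.eq_of_mem {V : Type u} [DecidableEq V] {G : Digraph V} {F S S' : Finset V}
    (h : IsStrongComponent G F S) (h' : IsStrongComponent G F S') {v : V} (hv : v ∈ S)
    (hv' : v ∈ S') : S = S' := by
  have hU : (∀ w ∈ S ∪ S', w ∉ F) ∧ ∀ a ∈ S ∪ S', ∀ b ∈ S ∪ S', ReachAvoiding G F a b := by
    have to_v : ∀ a ∈ S ∪ S', ReachAvoiding G F a v := fun a ha =>
      (Finset.mem_union.1 ha).elim (fun ha => h.2.1.2 a ha v hv) (fun ha => h'.2.1.2 a ha v hv')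
    have from_v : ∀ a ∈ S ∪ S', ReachAvoiding G F v a := fun a ha =>
      (Finset.mem_union.1 ha).elim (fun ha => h.2.1.2 v hv a ha) (fun ha => h'.2.1.2 v hv' a ha)
    refine ⟨fun w hw => ?_, fun a ha b hb => (to_v a ha).trans (from_v b hb)⟩
    exact (Finset.mem_union.1 hw).elim (h.2.1.1 w) (h'.2.1.1 w)
  have e1 := h.2.2 hU Finset.subset_union_left
  have e2 := h'.2.2 hU Finset.subset_union_right
  exact Finset.Subset.antisymm (Finset.subset_union_left.trans e2)
    (Finset.subset_union_right.trans e1)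

/-- Among the ancestors of `v` in `G_F`, one with the fewest ancestors has a source component as
its set of ancestors. -/
lemma exists_isSourceComponent_reach {V : Type u} [Fintype V] (G : Digraph V) (F : Finset V)
    (v : V) (hv : v ∉ F) :
    ∃ S, IsSourceComponent G F S ∧ ∀ s ∈ S, ReachAvoiding G F s v := by
  classical
  let anc : V → Finset V := fun w => Finset.univ.filter fun a => a ∉ F ∧ ReachAvoiding G F a w
  have mem_anc : ∀ a w, a ∈ anc w ↔ a ∉ F ∧ ReachAvoiding G F a w := fun a w => by simp [anc]
  obtain ⟨w, hw, hmin⟩ := Finset.exists_min_image (anc v) (fun w => (anc w).card)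
    ⟨v, (mem_anc v v).2 ⟨hv, Relation.ReflTransGen.refl⟩⟩
  obtain ⟨hwF, hwv⟩ := (mem_anc _ _).1 hw
  have hww : w ∈ anc w := (mem_anc w w).2 ⟨hwF, Relation.ReflTransGen.refl⟩
  have back : ∀ a ∈ anc w, ReachAvoiding G F w a := by
    intro a ha
    obtain ⟨haF, haw⟩ := (mem_anc _ _).1 ha
    have hsub : anc a ⊆ anc w := fun b hb =>
      (mem_anc _ _).2 ⟨((mem_anc _ _).1 hb).1, ((mem_anc _ _).1 hb).2.trans haw⟩
    have heq := Finset.eq_of_subset_of_card_le hsub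
      (hmin a ((mem_anc _ _).2 ⟨haF, haw.trans hwv⟩))
    rw [← heq] at hww
    exact ((mem_anc _ _).1 hww).2
  refine ⟨anc w, ⟨⟨⟨w, hww⟩, ⟨fun a ha => ((mem_anc _ _).1 ha).1, fun a ha b hb => ?_⟩, ?_⟩, ?_⟩,
    fun s hs => ((mem_anc _ _).1 hs).2.trans hwv⟩
  · exact ((mem_anc _ _).1 ha).2.trans (back b hb)
  · intro T hT hle t ht
    exact (mem_anc _ _).2 ⟨hT.1 t ht, hT.2 t ht w (hle hww)⟩
  · intro a b ha hb hab
    exact ha ((mem_anc _ _).2 ⟨hab.1, .head hab ((mem_anc _ _).1 hb).2⟩)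

/-- A set with more than `f` elements is not covered by at most `f` faulty nodes. -/
lemma exists_mem_notMem_of_card {V : Type u} {S B : Finset V} {f : ℕ} (hS : f + 1 ≤ S.card)
    (hB : B.card ≤ f) : ∃ v ∈ S, v ∉ B :=
  Finset.exists_mem_notMem_of_card_lt_card (by omega)

/-! ### Runs and views -/

lemma Run.view_suffix {V : Type u} [DecidableEq V] (e : Run V) (v : V) {t t' : ℕ} (h : t ≤ t') :
    e.view v t <:+ e.view v t' := by
  induction t', h using Nat.le_induction with
  | base => exact List.suffix_rfl
  | succ n _ ih =>
    simp only [Run.view]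
    split_ifs
    · exact ih.trans (List.suffix_cons _ _)
    · exact ih

lemma Run.obs_eq_some {V : Type u} {e : Run V} {t : ℕ} {p : V} {m : Msg V} :
    e.obs t = some (p, m) ↔
      ∃ s, e.recv t = some s ∧ e.actor s = p ∧ e.sent s (e.actor t) = some m := by
  simp only [Run.obs, Option.bind_eq_some_iff, Option.map_eq_some_iff, Prod.mk.injEq]
  constructor
  · rintro ⟨s, hs, m', hm', rfl, rfl⟩
    exact ⟨s, hs, rfl, hm'⟩
  · rintro ⟨s, hs, rfl, hm⟩
    exact ⟨s, hs, m, hm, rfl, rfl⟩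

lemma Derivable.trans {V : Type u} {K K' : Set V} {R R' : Set (Msg V)} {m : Msg V}
    (h : Derivable K R m) (hK : K ⊆ K') (hR : ∀ m ∈ R, Derivable K' R' m) :
    Derivable K' R' m := by
  induction h with
  | received h => exact hR _ h
  | real x => exact .real x
  | node v => exact .node v
  | pair _ _ h₁ h₂ => exact .pair h₁ h₂
  | fst _ h => exact .fst h
  | snd _ h => exact .snd h
  | sign hu _ h => exact .sign (hK hu) h
  | unsign _ h => exact .unsign h

/-! ### Parts of messages -/

/-- `Comp b m`: the message `b` is one of the items bundled in `m`, read without opening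
signatures. -/
inductive Comp {V : Type u} (b : Msg V) : Msg V → Prop where
  | refl : Comp b b
  | left {m₁ m₂ : Msg V} : Comp b m₁ → Comp b (.pair m₁ m₂)
  | right {m₁ m₂ : Msg V} : Comp b m₂ → Comp b (.pair m₁ m₂)

/-- `Occurs b m`: the message `b` occurs in `m`, possibly inside signed clear text. -/
inductive Occurs {V : Type u} (b : Msg V) : Msg V → Prop where
  | refl : Occurs b b
  | left {m₁ m₂ : Msg V} : Occurs b m₁ → Occurs b (.pair m₁ m₂)
  | right {m₁ m₂ : Msg V} : Occurs b m₂ → Occurs b (.pair m₁ m₂)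
  | signed {u : V} {m : Msg V} : Occurs b m → Occurs b (.signed u m)

lemma Comp.trans {V : Type u} {a b c : Msg V} (h : Comp a b) (h' : Comp b c) : Comp a c := by
  induction h' with
  | refl => exact h
  | left _ ih => exact ih.left
  | right _ ih => exact ih.right

lemma Occurs.trans {V : Type u} {a b c : Msg V} (h : Occurs a b) (h' : Occurs b c) :
    Occurs a c := by
  induction h' with
  | refl => exact h
  | left _ ih => exact ih.left
  | right _ ih => exact ih.right
  | signed _ ih => exact ih.signed

lemma Comp.occurs {V : Type u} {b m : Msg V} (h : Comp b m) : Occurs b m := by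
  induction h with
  | refl => exact .refl
  | left _ ih => exact ih.left
  | right _ ih => exact ih.right

/-- Unforgeability: a signature of `u` in a message made without the key of `u` was already
present in a received message. -/
lemma Derivable.occurs_signed {V : Type u} {K : Set V} {R : Set (Msg V)} {m c : Msg V} {u : V}
    (h : Derivable K R m) (hu : u ∉ K) (ho : Occurs (.signed u c) m) :
    ∃ m' ∈ R, Occurs (.signed u c) m' := by
  induction h with
  | received h => exact ⟨_, h, ho⟩
  | real x => cases ho
  | node v => cases ho
  | pair _ _ h₁ h₂ =>
    cases ho with
    | left ho => exact h₁ ho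
    | right ho => exact h₂ ho
  | fst _ h => exact h ho.left
  | snd _ h => exact h ho.right
  | sign hv _ h =>
    cases ho with
    | refl => exact absurd hv hu
    | signed ho => exact h ho
  | unsign _ h => exact h ho.signed

/-! ### Justified blocks -/

/-- The block of node `u` at level `k` with value `y` and supporting material `L`. -/
def block {V : Type u} (u : V) (k : ℕ) (y : ℝ) (L : Msg V) : Msg V :=
  .signed u (.pair (.real k) (.pair (.real y) L))

lemma block_inj {V : Type u} {u u' : V} {k k' : ℕ} {y y' : ℝ} {L L' : Msg V} :
    block u k y L = block u' k' y' L' ↔ u = u' ∧ k = k' ∧ y = y' ∧ L = L' := by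
  simp [block]

lemma comp_block_iff {V : Type u} {u u' : V} {k k' : ℕ} {y y' : ℝ} {L L' : Msg V} :
    Comp (block u k y L) (block u' k' y' L') ↔ u = u' ∧ k = k' ∧ y = y' ∧ L = L' := by
  rw [← block_inj]
  refine ⟨fun h => ?_, fun h => h ▸ .refl⟩
  generalize block u k y L = b at h
  unfold block at h ⊢
  cases h
  rfl

/-- The sets from which a node collects blocks: source components that remain after the removal of
at most `f` nodes. -/
def Quorum {V : Type u} (G : Digraph V) (f : ℕ) (S : Finset V) : Prop :=
  ∃ F : Finset V, F.card ≤ f ∧ IsSourceComponent G F S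

/-- `Aggregates f k S g y`: `y` is an admissible value at level `k + 1` for a node that has
collected the level `k` values `g s` of the nodes `s ∈ S`. From inputs, which faulty nodes can
choose freely, `y` must survive the removal of the `f` smallest and the `f` largest ones; at the
higher levels all values are trustworthy and `y` is the midpoint of the extreme ones. -/
def Aggregates {V : Type u} (f : ℕ) : ℕ → Finset V → (V → ℝ) → ℝ → Prop
  | 0, S, g, y =>
    f + 1 ≤ (S.filter fun s => g s ≤ y).card ∧ f + 1 ≤ (S.filter fun s => y ≤ g s).card
  | _ + 1, S, g, y =>
    ∃ s ∈ S, ∃ s' ∈ S, (∀ w ∈ S, g s ≤ g w ∧ g w ≤ g s') ∧ y = (g s + g s') / 2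

/-- `Justified G f k y L`: the material `L` proves that `y` is an admissible value at level `k`.
At level `0` (inputs) nothing is to be proved; at level `k + 1` the bundle `L` must contain
justified level `k` blocks of all nodes of some quorum, whose values aggregate to `y`. -/
def Justified {V : Type u} (G : Digraph V) (f : ℕ) : ℕ → ℝ → Msg V → Prop
  | 0, _, _ => True
  | k + 1, y, L => ∃ (S : Finset V) (g : V → ℝ), Quorum G f S ∧
      (∀ s ∈ S, ∃ L', Comp (block s k (g s) L') L ∧ Justified G f k (g s) L') ∧
      Aggregates f k S g y

/-- The bundle `m` contains a justified level `k` block of `u` with value `y`. -/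
def Accepted {V : Type u} (G : Digraph V) (f : ℕ) (u : V) (k : ℕ) (y : ℝ) (m : Msg V) : Prop :=
  ∃ L, Comp (block u k y L) m ∧ Justified G f k y L

lemma Accepted.mono {V : Type u} {G : Digraph V} {f : ℕ} {u : V} {k : ℕ} {y : ℝ} {m m' : Msg V}
    (h : Accepted G f u k y m) (hm : Comp m m') : Accepted G f u k y m' :=
  let ⟨L, hc, hj⟩ := h
  ⟨L, hc.trans hm, hj⟩

lemma Justified.mono {V : Type u} {G : Digraph V} {f : ℕ} {k : ℕ} {y : ℝ} {m m' : Msg V}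
    (h : Justified G f k y m) (hm : Comp m m') : Justified G f k y m' := by
  cases k with
  | zero => trivial
  | succ k =>
    obtain ⟨S, g, hS, hg, hy⟩ := h
    exact ⟨S, g, hS, fun s hs => Accepted.mono (hg s hs) hm, hy⟩

lemma exists_aggregates_zero {V : Type u} {f : ℕ} {S : Finset V} (hS : 2 * f + 1 ≤ S.card)
    (g : V → ℝ) : ∃ y, Aggregates f 0 S g y := by
  classical
  let P := S.filter fun s => f + 1 ≤ (S.filter fun w => g w ≤ g s).card
  have hSne : S.Nonempty := Finset.card_pos.1 (by omega)
  have hP : P.Nonempty := by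
    obtain ⟨s, hs, hmax⟩ := Finset.exists_max_image S g hSne
    refine ⟨s, Finset.mem_filter.2 ⟨hs, ?_⟩⟩
    rw [Finset.filter_true_of_mem hmax]
    omega
  -- the value with rank `f + 1`
  obtain ⟨s, hs, hmin⟩ := Finset.exists_min_image P g hP
  refine ⟨g s, (Finset.mem_filter.1 hs).2, ?_⟩
  have hlow : (S.filter fun w => ¬ g s ≤ g w).card ≤ f := by
    by_contra hcon
    have hcon := not_le.1 hcon
    have hne : (S.filter fun w => ¬ g s ≤ g w).Nonempty := Finset.card_pos.1 (by omega)
    obtain ⟨w, hw, hwmax⟩ := Finset.exists_max_image _ g hne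
    obtain ⟨hwS, hws⟩ := Finset.mem_filter.1 hw
    refine hws (hmin w (Finset.mem_filter.2 ⟨hwS, ?_⟩))
    refine le_trans hcon (Finset.card_le_card fun a ha => ?_)
    exact Finset.mem_filter.2 ⟨(Finset.mem_filter.1 ha).1, hwmax a ha⟩
  have := Finset.card_filter_add_card_filter_not (s := S) (fun w => g s ≤ g w)
  change f + 1 ≤ (S.filter fun w => g s ≤ g w).card
  omega

lemma exists_aggregates {V : Type u} {f : ℕ} {S : Finset V} (hS : 2 * f + 1 ≤ S.card) (k : ℕ)
    (g : V → ℝ) : ∃ y, Aggregates f k S g y := by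
  cases k with
  | zero => exact exists_aggregates_zero hS g
  | succ k =>
    have hSne : S.Nonempty := Finset.card_pos.1 (by omega)
    obtain ⟨s, hs, hmin⟩ := Finset.exists_min_image S g hSne
    obtain ⟨s', hs', hmax⟩ := Finset.exists_max_image S g hSne
    exact ⟨_, s, hs, s', hs', fun w hw => ⟨hmin w hw, hmax w hw⟩, rfl⟩

/-! ### The algorithm -/

/-- Node `u` with the bundle `m` is ready to issue a block at level `p.1 + 1` with value `p.2`: it
has own blocks at all lower levels, none at this one, and `m` justifies the value. -/
def Ready {V : Type u} (G : Digraph V) (f : ℕ) (u : V) (m : Msg V) (p : ℕ × ℝ) : Prop :=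
  (∀ j ≤ p.1, ∃ y, Accepted G f u j y m) ∧ (¬ ∃ y, Accepted G f u (p.1 + 1) y m) ∧
    Justified G f (p.1 + 1) p.2 m

open Classical in
/-- Issue the next block of `u`, if `u` is ready to; its supporting material is the whole bundle. -/
noncomputable def advance {V : Type u} (G : Digraph V) (f : ℕ) (u : V) (m : Msg V) : Msg V :=
  if h : ∃ p, Ready G f u m p then .pair (block u (h.choose.1 + 1) h.choose.2 m) m else m

/-- The bundle of everything that node `u` has received or issued. -/
noncomputable def bundle {V : Type u} (G : Digraph V) (f : ℕ) (u : V) (x : ℝ) : View V → Msg V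
  | [] => block u 0 x (.real 0)
  | none :: h => advance G f u (bundle G f u x h)
  | some (_, m) :: h => advance G f u (.pair m (bundle G f u x h))

open Classical in
/-- The value of the first justified level `N` block of `u` in its own bundle. The recursion keeps
an earlier decision, so that the output is write-once on all views, even on those that do not occur
in an execution. -/
noncomputable def decision {V : Type u} (G : Digraph V) (f N : ℕ) (u : V) (x : ℝ) :
    View V → Option ℝ
  | [] => none
  | o :: h => match decision G f N u x h with
    | some y => some y
    | none => if hy : ∃ y, Accepted G f u N y (bundle G f u x (o :: h)) then some hy.choose
        else none

lemma advance_cases {V : Type u} (G : Digraph V) (f : ℕ) (u : V) (m : Msg V) :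
    (advance G f u m = m ∧ ¬ ∃ p, Ready G f u m p) ∨
      ∃ p, Ready G f u m p ∧ advance G f u m = .pair (block u (p.1 + 1) p.2 m) m := by
  unfold advance
  split_ifs with h
  · exact .inr ⟨_, h.choose_spec, rfl⟩
  · exact .inl ⟨rfl, h⟩

lemma comp_advance {V : Type u} (G : Digraph V) (f : ℕ) (u : V) (m : Msg V) :
    Comp m (advance G f u m) := by
  rcases advance_cases G f u m with ⟨h, -⟩ | ⟨p, -, h⟩ <;> rw [h]
  · exact .refl
  · exact .right .refl

/-- A node with own blocks at all levels up to `k` and with the material for level `k + 1` issues a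
block at level `k + 1` in its next step, unless it has one already. -/
lemma exists_accepted_advance {V : Type u} {G : Digraph V} {f : ℕ} {u : V} {k : ℕ} {y : ℝ}
    {m : Msg V}
    (hlow : ∀ j ≤ k, ∃ y, Accepted G f u j y m) (hj : Justified G f (k + 1) y m) :
    ∃ y, Accepted G f u (k + 1) y (advance G f u m) := by
  by_cases hown : ∃ y, Accepted G f u (k + 1) y m
  · obtain ⟨y, hy⟩ := hown
    exact ⟨y, hy.mono (comp_advance _ _ _ _)⟩
  · rcases advance_cases G f u m with ⟨-, h⟩ | ⟨q, hq, h⟩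
    · exact absurd ⟨(k, y), hlow, hown, hj⟩ h
    · have hqk : q.1 = k := by
        rcases lt_trichotomy q.1 k with hlt | heq | hgt
        · exact absurd (hlow _ hlt) hq.2.1
        · exact heq
        · exact absurd (hq.1 _ hgt) hown
      rw [h, ← hqk]
      exact ⟨q.2, m, .left .refl, hq.2.2⟩

lemma derivable_bundle {V : Type u} (G : Digraph V) (f : ℕ) (u : V) (x : ℝ) (h : View V) :
    Derivable {u} {m : Msg V | ∃ p : V, some (p, m) ∈ h} (bundle G f u x h) := by
  have adv : ∀ (R : Set (Msg V)) (m : Msg V), Derivable {u} R m →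
      Derivable {u} R (advance G f u m) := by
    intro R m hm
    rcases advance_cases G f u m with ⟨h, -⟩ | ⟨p, -, h⟩ <;> rw [h]
    · exact hm
    · exact .pair (.sign rfl (.pair (.real _) (.pair (.real _) hm))) hm
  induction h with
  | nil => exact .sign rfl (.pair (.real _) (.pair (.real _) (.real _)))
  | cons o h ih =>
    have ih' : Derivable {u} {m : Msg V | ∃ p : V, some (p, m) ∈ o :: h} (bundle G f u x h) :=
      ih.trans subset_rfl fun m ⟨p, hp⟩ => .received ⟨p, List.mem_cons_of_mem _ hp⟩
    rcases o with _ | ⟨p, m⟩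
    · exact adv _ _ ih'
    · exact adv _ _ (.pair (.received ⟨p, List.mem_cons_self⟩) ih')

/-- The algorithm: flood the whole bundle in each step and output the level `N` value. -/
noncomputable def blockAlgorithm {V : Type u} (G : Digraph V) (f N : ℕ) : Algorithm V where
  send v x h _ := some (bundle G f v x h)
  output v x h := decision G f N v x h
  authentic v x h w m hm := by
    cases hm
    exact derivable_bundle G f v x h
  write_once v x h o y hy := by simp [decision, hy]

lemma accepted_of_decision {V : Type u} {G : Digraph V} {f N : ℕ} {u : V} {x y : ℝ} {h : View V}
    (hd : decision G f N u x h = some y) :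
    ∃ h', h' <:+ h ∧ Accepted G f u N y (bundle G f u x h') := by
  induction h with
  | nil => simp [decision] at hd
  | cons o h ih =>
    cases hh : decision G f N u x h with
    | some z =>
      simp only [decision, hh] at hd
      obtain ⟨h', hs, ha⟩ := ih (hh.trans hd)
      exact ⟨h', hs.trans (List.suffix_cons _ _), ha⟩
    | none =>
      simp only [decision, hh] at hd
      split_ifs at hd with hy
      cases hd
      exact ⟨_, List.suffix_rfl, hy.choose_spec⟩

lemma exists_decision {V : Type u} {G : Digraph V} {f N : ℕ} {u : V} {x y : ℝ} {o : Obs V}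
    {h : View V} (ha : Accepted G f u N y (bundle G f u x (o :: h))) :
    ∃ z, decision G f N u x (o :: h) = some z := by
  cases hh : decision G f N u x h with
  | some z => exact ⟨z, by simp [decision, hh]⟩
  | none => exact ⟨_, by simp only [decision, hh]; exact dif_pos ⟨y, ha⟩⟩

lemma comp_bundle_of_suffix {V : Type u} {G : Digraph V} {f : ℕ} {u : V} {x : ℝ} {h h' : View V}
    (hs : h' <:+ h) : Comp (bundle G f u x h') (bundle G f u x h) := by
  induction h with
  | nil => rw [List.suffix_nil.1 hs]; exact .refl
  | cons o h ih =>
    rcases List.suffix_cons_iff.1 hs with rfl | hs'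
    · exact .refl
    · rcases o with _ | ⟨p, m⟩
      · exact (ih hs').trans (comp_advance _ _ _ _)
      · exact (ih hs').right.trans (comp_advance _ _ _ _)

/-! ### Knowledge of the non-faulty nodes during an execution -/

/-- The bundle of node `v` just before step `t`. -/
noncomputable def know {V : Type u} [DecidableEq V] (G : Digraph V) (f : ℕ) (x : V → ℝ) (e : Run V)
    (v : V) (t : ℕ) : Msg V :=
  bundle G f v (x v) (e.view v t)

section Execution

variable {V : Type u} [DecidableEq V] {G : Digraph V} {f N : ℕ} {x : V → ℝ} {B : Finset V}
  {e : Run V}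

lemma know_mono (v : V) {t t' : ℕ} (h : t ≤ t') : Comp (know G f x e v t) (know G f x e v t') :=
  comp_bundle_of_suffix (e.view_suffix v h)

lemma know_succ_of_ne {v : V} {t : ℕ} (h : e.actor t ≠ v) :
    know G f x e v (t + 1) = know G f x e v t := by
  simp [know, Run.view, h]

lemma know_succ {v : V} {t : ℕ} (h : e.actor t = v) :
    (know G f x e v (t + 1) = advance G f v (know G f x e v t)) ∨
      ∃ p m, e.obs t = some (p, m) ∧
        know G f x e v (t + 1) = advance G f v (.pair m (know G f x e v t)) := by
  rcases ho : e.obs t with _ | ⟨p, m⟩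
  · left; simp [know, Run.view, h, ho, bundle]
  · right; exact ⟨p, m, rfl, by simp [know, Run.view, h, ho, bundle]⟩

lemma comp_know_of_obs {v p : V} {t : ℕ} {m : Msg V} (h : e.actor t = v)
    (ho : e.obs t = some (p, m)) : Comp m (know G f x e v (t + 1)) := by
  have : know G f x e v (t + 1) = advance G f v (.pair m (know G f x e v t)) := by
    simp [know, Run.view, h, ho, bundle]
  rw [this]
  exact Comp.trans (.left .refl) (comp_advance _ _ _ _)

lemma IsExecution.sent_eq (he : IsExecution G (blockAlgorithm G f N) x B e) {t : ℕ}
    (ht : e.actor t ∉ B) (w : V) : e.sent t w = some (know G f x e (e.actor t) (t + 1)) := by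
  rw [he.follows t ht]; rfl

lemma IsExecution.obs_sent {A : Algorithm V} (he : IsExecution G A x B e) {t : ℕ} {p : V}
    {m : Msg V} (ho : e.obs t = some (p, m)) : ∃ s < t, ∃ w, e.sent s w = some m := by
  obtain ⟨s, hs, -, hm⟩ := Run.obs_eq_some.1 ho
  exact ⟨s, (he.integrity t s hs).1, _, hm⟩

/-- A signature of the non-faulty node `u` occurring in a bundle of a non-faulty node or in a
message has been made by `u` before. -/
lemma IsExecution.comp_know_of_occurs (he : IsExecution G (blockAlgorithm G f N) x B e) {u : V}
    (hu : u ∉ B) (c : Msg V) (t : ℕ) :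
    (∀ p ∉ B, Occurs (.signed u c) (know G f x e p t) →
      Comp (.signed u c) (know G f x e u t)) ∧
    ∀ s < t, ∀ w m, e.sent s w = some m → Occurs (.signed u c) m →
      Comp (.signed u c) (know G f x e u t) := by
  induction t with
  | zero =>
    refine ⟨fun p _ ho => ?_, fun s hs => absurd hs (Nat.not_lt_zero s)⟩
    have h0 : know G f x e p 0 = block p 0 (x p) (.real 0) := rfl
    rw [h0] at ho
    cases ho with
    | refl => exact .refl
    | signed ho => cases ho with
      | left h => cases h
      | right h => cases h with
        | left h => cases h
        | right h => cases h
  | succ t ih =>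
    obtain ⟨ihk, ihs⟩ := ih
    have mono := know_mono (G := G) (f := f) (x := x) (e := e) u (Nat.le_succ t)
    have hk : ∀ p ∉ B, Occurs (.signed u c) (know G f x e p (t + 1)) →
        Comp (.signed u c) (know G f x e u (t + 1)) := by
      intro p hp ho
      by_cases hact : e.actor t = p
      · have adv : ∀ m', (Occurs (.signed u c) m' → Comp (.signed u c) (know G f x e u t)) →
            know G f x e p (t + 1) = advance G f p m' →
            Comp (.signed u c) (know G f x e u (t + 1)) := by
          intro m' hm' heq
          rw [heq] at ho
          rcases advance_cases G f p m' with ⟨h, -⟩ | ⟨q, -, h⟩ <;> rw [h] at ho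
          · exact (hm' ho).trans mono
          · cases ho with
            | right ho => exact (hm' ho).trans mono
            | left ho =>
              unfold block at ho
              cases ho with
              | refl => rw [heq, h]; exact .left .refl
              | signed ho => cases ho with
                | left h => cases h
                | right h => cases h with
                  | left h => cases h
                  | right h => exact (hm' h).trans mono
        rcases know_succ (G := G) (f := f) (x := x) hact with h | ⟨q, m, hobs, h⟩
        · exact adv _ (ihk p hp) h
        · refine adv _ (fun ho => ?_) h
          cases ho with
          | right ho => exact ihk p hp ho
          | left ho =>
            obtain ⟨s, hs, w, hm⟩ := he.obs_sent hobs
            exact ihs s hs w m hm ho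
      · rw [know_succ_of_ne hact] at ho
        exact (ihk p hp ho).trans mono
    refine ⟨hk, fun s hs w m hm ho => ?_⟩
    rcases Nat.lt_succ_iff_lt_or_eq.1 hs with hs | rfl
    · exact (ihs s hs w m hm ho).trans mono
    · by_cases hact : e.actor s ∈ B
      · obtain ⟨m', ⟨s', hs', -, q, hobs⟩, ho'⟩ :=
          (he.unforgeable s hact w m hm).occurs_signed (by simpa using hu) ho
        obtain ⟨r, hr, w', hm'⟩ := he.obs_sent hobs
        exact (ihs r (hr.trans_le hs') w' m' hm' ho').trans mono
      · rw [he.sent_eq hact w, Option.some.injEq] at hm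
        subst hm
        exact hk _ hact ho

/-- Non-faulty nodes issue only one justified block at each level: own blocks in received messages
are old, and a new one is issued only at a level without any. -/
lemma IsExecution.accepted_unique_at (he : IsExecution G (blockAlgorithm G f N) x B e) {u : V}
    (hu : u ∉ B) (k : ℕ) (t : ℕ) : ∀ y y', Accepted G f u k y (know G f x e u t) →
      Accepted G f u k y' (know G f x e u t) → y = y' := by
  induction t with
  | zero =>
    rintro y y' ⟨L, h, -⟩ ⟨L', h', -⟩
    have h0 : know G f x e u 0 = block u 0 (x u) (.real 0) := rfl
    rw [h0, comp_block_iff] at h h'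
    exact h.2.2.1.trans h'.2.2.1.symm
  | succ t ih =>
    by_cases hact : e.actor t = u
    · have adv : ∀ m, (∀ y, Accepted G f u k y m → Accepted G f u k y (know G f x e u t)) →
          know G f x e u (t + 1) = advance G f u m →
          ∀ y y', Accepted G f u k y (know G f x e u (t + 1)) →
            Accepted G f u k y' (know G f x e u (t + 1)) → y = y' := by
        intro m hm heq y y' hy hy'
        rw [heq] at hy hy'
        rcases advance_cases G f u m with ⟨h, -⟩ | ⟨q, hq, h⟩ <;> rw [h] at hy hy'
        · exact ih y y' (hm y hy) (hm y' hy')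
        · -- a block in the new bundle is old, or it is the new one
          have new : ∀ z, Accepted G f u k z (.pair (block u (q.1 + 1) q.2 m) m) →
              Accepted G f u k z m ∨ (k = q.1 + 1 ∧ z = q.2) := by
            rintro z ⟨L, hc, hj⟩
            cases hc with
            | left hc =>
              rw [comp_block_iff] at hc
              exact .inr ⟨hc.2.1, hc.2.2.1⟩
            | right hc => exact .inl ⟨L, hc, hj⟩
          rcases new y hy with h1 | ⟨rfl, rfl⟩
          · rcases new y' hy' with h2 | ⟨rfl, rfl⟩
            · exact ih y y' (hm y h1) (hm y' h2)
            · exact absurd ⟨y, h1⟩ hq.2.1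
          · rcases new y' hy' with h2 | ⟨-, rfl⟩
            · exact absurd ⟨y', h2⟩ hq.2.1
            · rfl
      rcases know_succ (G := G) (f := f) (x := x) hact with h | ⟨p, m, hobs, h⟩
      · exact adv _ (fun _ hy => hy) h
      · refine adv _ (fun y hy => ?_) h
        obtain ⟨L, hc, hj⟩ := hy
        refine ⟨L, ?_, hj⟩
        cases hc with
        | right hc => exact hc
        | left hc =>
          obtain ⟨s, hs, w, hm⟩ := he.obs_sent hobs
          exact (he.comp_know_of_occurs hu _ t).2 s hs w m hm hc.occurs
    · rw [know_succ_of_ne hact]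
      exact ih

/-! ### Convergence -/

/-- All signatures of non-faulty nodes in `L` have been made by these nodes. -/
def Authentic (G : Digraph V) (f : ℕ) (x : V → ℝ) (B : Finset V) (e : Run V) (L : Msg V) : Prop :=
  ∀ u ∉ B, ∀ c, Occurs (.signed u c) L → ∃ t, Comp (.signed u c) (know G f x e u t)

/-- `y` is the value of some justified level `k` block that can turn up in the execution, be it
signed by a faulty or a non-faulty node. -/
def Attested (G : Digraph V) (f : ℕ) (x : V → ℝ) (B : Finset V) (e : Run V) (k : ℕ) (y : ℝ) :
    Prop :=
  ∃ L, Authentic G f x B e L ∧ Justified G f k y L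

lemma IsExecution.authentic_know (he : IsExecution G (blockAlgorithm G f N) x B e) {v : V}
    (hv : v ∉ B) (t : ℕ) : Authentic G f x B e (know G f x e v t) :=
  fun _ hu c ho => ⟨t, (he.comp_know_of_occurs hu c t).1 v hv ho⟩

lemma Authentic.of_occurs {L L' : Msg V} (h : Authentic G f x B e L) (ho : Occurs L' L) :
    Authentic G f x B e L' := fun u hu c hc => h u hu c (hc.trans ho)

lemma Authentic.of_block {L m : Msg V} {u : V} {k : ℕ} {y : ℝ} (h : Authentic G f x B e m)
    (hc : Comp (block u k y L) m) : Authentic G f x B e L :=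
  h.of_occurs (Occurs.trans (.signed (.right (.right .refl))) hc.occurs)

lemma Attested.of_accepted {m : Msg V} {u : V} {k : ℕ} {y : ℝ} (h : Authentic G f x B e m)
    (ha : Accepted G f u k y m) : Attested G f x B e k y :=
  let ⟨L, hc, hj⟩ := ha
  ⟨L, h.of_block hc, hj⟩

/-- An attested value at level `k + 1` aggregates attested values of a quorum, those of non-faulty
members being genuine. -/
lemma Attested.succ {k : ℕ} {y : ℝ} (h : Attested G f x B e (k + 1) y) :
    ∃ S g, Quorum G f S ∧ Aggregates f k S g y ∧ (∀ s ∈ S, Attested G f x B e k (g s)) ∧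
      ∀ s ∈ S, s ∉ B → ∃ t, Accepted G f s k (g s) (know G f x e s t) := by
  obtain ⟨L, hL, S, g, hS, hg, hy⟩ := h
  refine ⟨S, g, hS, hy, fun s hs => .of_accepted hL (hg s hs), fun s hs hsB => ?_⟩
  obtain ⟨L', hc, hj⟩ := hg s hs
  obtain ⟨t, ht⟩ := hL s hsB _ hc.occurs
  exact ⟨t, L', ht, hj⟩

lemma IsExecution.accepted_unique (he : IsExecution G (blockAlgorithm G f N) x B e) {u : V}
    (hu : u ∉ B) {k t t' : ℕ} {y y' : ℝ} (h : Accepted G f u k y (know G f x e u t))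
    (h' : Accepted G f u k y' (know G f x e u t')) : y = y' :=
  he.accepted_unique_at hu k (max t t') y y' (h.mono (know_mono u (le_max_left _ _)))
    (h'.mono (know_mono u (le_max_right _ _)))

lemma accepted_input (v : V) (t : ℕ) : Accepted G f v 0 (x v) (know G f x e v t) :=
  ⟨.real 0, know_mono (t := 0) v (Nat.zero_le t), trivial⟩

/-- An aggregate of inputs lies between those of two non-faulty nodes, because at least `f + 1`
collected inputs are on either side of it; later values are midpoints. -/
lemma IsExecution.attested_mem_hull (he : IsExecution G (blockAlgorithm G f N) x B e)
    (hB : B.card ≤ f) {k : ℕ} {y : ℝ} (h : Attested G f x B e (k + 1) y) :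
    y ∈ convexHull ℝ (x '' {w | w ∉ B}) := by
  have hconv := convex_convexHull ℝ (x '' {w | w ∉ B})
  induction k generalizing y with
  | zero =>
    obtain ⟨S, g, -, ⟨h1, h2⟩, -, hgen⟩ := h.succ
    have input : ∀ s ∈ S, s ∉ B → g s ∈ convexHull ℝ (x '' {w | w ∉ B}) := by
      intro s hs hsB
      obtain ⟨t, ht⟩ := hgen s hs hsB
      rw [he.accepted_unique hsB ht (accepted_input s t)]
      exact subset_convexHull ℝ _ ⟨s, hsB, rfl⟩
    obtain ⟨s, hs, hsB⟩ := exists_mem_notMem_of_card h1 hB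
    obtain ⟨s', hs', hsB'⟩ := exists_mem_notMem_of_card h2 hB
    rw [Finset.mem_filter] at hs hs'
    exact hconv.ordConnected.out (input s hs.1 hsB) (input s' hs'.1 hsB') ⟨hs.2, hs'.2⟩
  | succ k ih =>
    obtain ⟨S, g, -, ⟨s, hs, s', hs', hext, rfl⟩, hatt, -⟩ := h.succ
    have := hext s' hs'
    exact hconv.ordConnected.out (ih (hatt s hs)) (ih (hatt s' hs'))
      ⟨by linarith, by linarith⟩

/-- Two quorums share a non-faulty node, hence a genuine value, which lies between the extreme
values of both; so the two midpoints are at most half the diameter apart. -/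
lemma IsExecution.attested_dist (he : IsExecution G (blockAlgorithm G f N) x B e)
    (hA : ConditionA G f) (hB : B.card ≤ f) {a b : ℝ} (hx : ∀ v, x v ∈ Set.Icc a b) {k : ℕ}
    {y y' : ℝ} (h : Attested G f x B e (k + 1) y) (h' : Attested G f x B e (k + 1) y') :
    y - y' ≤ (b - a) / 2 ^ k := by
  induction k generalizing y y' with
  | zero =>
    have hsub : convexHull ℝ (x '' {w | w ∉ B}) ⊆ Set.Icc a b :=
      convexHull_min (by rintro _ ⟨v, -, rfl⟩; exact hx v) (convex_Icc a b)
    have h1 := hsub (he.attested_mem_hull hB h)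
    have h2 := hsub (he.attested_mem_hull hB h')
    simp only [pow_zero, div_one]
    linarith [h1.2, h2.1]
  | succ k ih =>
    obtain ⟨S, g, ⟨F, hF, hS⟩, ⟨s, hs, s₁, hs₁, hext, rfl⟩, hatt, hgen⟩ := h.succ
    obtain ⟨S', g', ⟨F', hF', hS'⟩, ⟨s', hs', s₁', hs₁', hext', rfl⟩, hatt', hgen'⟩ := h'.succ
    obtain ⟨c, hc, hcB⟩ := exists_mem_notMem_of_card (hA.inter F F' S S' hF hF' hS hS') hB
    rw [Finset.mem_inter] at hc
    obtain ⟨t, ht⟩ := hgen c hc.1 hcB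
    obtain ⟨t', ht'⟩ := hgen' c hc.2 hcB
    have hcc := he.accepted_unique hcB ht ht'
    have h1 := (hext c hc.1).1
    have h2 := (hext' c hc.2).2
    have h3 := ih (hatt s₁ hs₁) (hatt' s' hs')
    rw [pow_succ, ← div_div]
    linarith

/-! ### Termination -/

lemma IsExecution.flood_edge (he : IsExecution G (blockAlgorithm G f N) x B e) {p q : V} {t : ℕ}
    (h : EdgeAvoiding G B p q) {b : Msg V} (hb : Comp b (know G f x e p t)) :
    ∃ t', Comp b (know G f x e q t') := by
  obtain ⟨hp, hq, hpq⟩ := h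
  obtain ⟨s, hs, rfl⟩ := he.fair p hp t
  have hsent := he.sent_eq hp q
  obtain ⟨r, hr, hrecv⟩ := he.reliable s q _ hq hpq hsent
  refine ⟨r + 1, (hb.trans (know_mono _ (hs.trans (Nat.le_succ s)))).trans
    (comp_know_of_obs hr (Run.obs_eq_some.2 ⟨s, hrecv, rfl, ?_⟩))⟩
  rw [hr, hsent]

lemma IsExecution.flood (he : IsExecution G (blockAlgorithm G f N) x B e) {p q : V} {t : ℕ}
    (h : ReachAvoiding G B p q) {b : Msg V} (hb : Comp b (know G f x e p t)) :
    ∃ t', Comp b (know G f x e q t') := by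
  induction h with
  | refl => exact ⟨t, hb⟩
  | tail _ hpq ih =>
    obtain ⟨t', ht'⟩ := ih
    exact he.flood_edge hpq ht'

/-- Every non-faulty node issues blocks at all levels: the source component of the graph without
the faulty nodes is a quorum, and its blocks reach every non-faulty node along fault-free paths. -/
lemma IsExecution.exists_accepted [Fintype V]
    (he : IsExecution G (blockAlgorithm G f N) x B e) (hA : ConditionA G f) (hB : B.card ≤ f)
    (k : ℕ) : ∃ t, ∀ v ∉ B, ∀ j ≤ k, ∃ y, Accepted G f v j y (know G f x e v t) := by
  -- for finitely many properties that persist, a common time suffices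
  have uniform : ∀ P : V → ℕ → Prop, (∀ v t t', t ≤ t' → P v t → P v t') →
      (∀ v, ∃ t, P v t) → ∃ t, ∀ v, P v t := by
    intro P hP hex
    choose τ hτ using hex
    exact ⟨Finset.univ.sup τ, fun v => hP v _ _ (Finset.le_sup (Finset.mem_univ v)) (hτ v)⟩
  induction k with
  | zero => exact ⟨0, fun v _ j hj => by rw [Nat.le_zero.1 hj]; exact ⟨_, accepted_input v 0⟩⟩
  | succ k ih =>
    obtain ⟨t₀, ht₀⟩ := ih
    refine uniform (fun v t => v ∉ B → ∀ j ≤ k + 1, ∃ y, Accepted G f v j y (know G f x e v t))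
      (fun v t t' htt h hv j hj => ?_) fun v => ?_
    · obtain ⟨y, hy⟩ := h hv j hj
      exact ⟨y, hy.mono (know_mono v htt)⟩
    by_cases hv : v ∈ B
    · exact ⟨0, fun h => absurd hv h⟩
    obtain ⟨S, hS, hreach⟩ := exists_isSourceComponent_reach G B v hv
    have hSB := hS.inClosed.1
    have hval : ∀ s, ∃ y, s ∈ S → Accepted G f s k y (know G f x e s t₀) := fun s => by
      by_cases hs : s ∈ S
      · obtain ⟨y, hy⟩ := ht₀ s (hSB s hs) k le_rfl
        exact ⟨y, fun _ => hy⟩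
      · exact ⟨0, fun h => absurd h hs⟩
    choose g hg using hval
    obtain ⟨t₁, ht₁⟩ := uniform (fun s t => s ∈ S → Accepted G f s k (g s) (know G f x e v t))
      (fun s t t' htt h hs => (h hs).mono (know_mono v htt)) fun s => by
        by_cases hs : s ∈ S
        · obtain ⟨L, hc, hj⟩ := hg s hs
          obtain ⟨t, ht⟩ := he.flood (hreach s hs) hc
          exact ⟨t, fun _ => ⟨L, ht, hj⟩⟩
        · exact ⟨0, fun h => absurd h hs⟩
    obtain ⟨y, hy⟩ := exists_aggregates (hA.size B S hB hS) k g
    obtain ⟨t₂, ht₂, hact⟩ := he.fair v hv (max t₀ t₁)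
    have hlow : ∀ j ≤ k, ∃ y, Accepted G f v j y (know G f x e v t₂) := fun j hj => by
      obtain ⟨y, hy⟩ := ht₀ v hv j hj
      exact ⟨y, hy.mono (know_mono v ((le_max_left _ _).trans ht₂))⟩
    have hjust : Justified G f (k + 1) y (know G f x e v t₂) :=
      ⟨S, g, ⟨B, hB, hS⟩,
        fun s hs => (ht₁ s hs).mono (know_mono v ((le_max_right _ _).trans ht₂)), hy⟩
    refine ⟨t₂ + 1, fun _ j hj => ?_⟩
    rcases Nat.le_succ_iff.1 hj with hj | rfl
    · obtain ⟨y, hy⟩ := hlow j hj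
      exact ⟨y, hy.mono (know_mono v (Nat.le_succ _))⟩
    · rcases know_succ (G := G) (f := f) (x := x) hact with h | ⟨p, m, -, h⟩ <;> rw [h]
      · exact exists_accepted_advance hlow hjust
      · exact exists_accepted_advance
          (fun j hj => (hlow j hj).imp fun _ h => h.mono (.right .refl)) (hjust.mono (.right .refl))

end Execution

lemma view_eq_of_suffix {V : Type u} [DecidableEq V] {e : Run V} {v : V} {t : ℕ} {h : View V}
    (hs : h <:+ e.view v t) : ∃ t', h = e.view v t' := by
  induction t with
  | zero => exact ⟨0, List.suffix_nil.1 hs⟩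
  | succ t ih =>
    simp only [Run.view] at hs
    split_ifs at hs with hact
    · rcases List.suffix_cons_iff.1 hs with rfl | hs'
      · exact ⟨t + 1, by simp [Run.view, hact]⟩
      · exact ih hs'
    · exact ih hs

lemma blockAlgorithm_solves {V : Type u} [Fintype V] [DecidableEq V] {G : Digraph V} {f k : ℕ}
    (hA : ConditionA G f) {I : Set ℝ} {a b ε : ℝ} (hI : I ⊆ Set.Icc a b)
    (hε : (b - a) / 2 ^ k ≤ ε) :
    SolvesApproxConsensus G f I ε (blockAlgorithm G f (k + 1)) := by
  have attested : ∀ (x : V → ℝ) (B : Finset V) (e : Run V),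
      IsExecution G (blockAlgorithm G f (k + 1)) x B e → ∀ v, v ∉ B → ∀ y,
      Outputs (blockAlgorithm G f (k + 1)) x e v y → Attested G f x B e (k + 1) y := by
    rintro x B e he v hv y ⟨t, ht⟩
    obtain ⟨h', hs, ha⟩ := accepted_of_decision ht
    obtain ⟨t', rfl⟩ := view_eq_of_suffix hs
    exact .of_accepted (he.authentic_know hv t') ha
  refine ⟨fun x B e _ hB he v hv => ?_, fun x B e _ hB he v hv y hy => ?_,
    fun x B e hx hB he v w hv hw y z hy hz => ?_⟩
  · obtain ⟨t, ht⟩ := he.exists_accepted hA hB (k + 1)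
    obtain ⟨y, hy⟩ := ht v hv _ le_rfl
    obtain ⟨t', htt, hact⟩ := he.fair v hv t
    have hview : e.view v (t' + 1) = e.obs t' :: e.view v t' := by simp [Run.view, hact]
    have hy' := hy.mono (know_mono v (htt.trans (Nat.le_succ t')))
    rw [know, hview] at hy'
    obtain ⟨z, hz⟩ := exists_decision hy'
    exact ⟨z, t' + 1, by rw [hview]; exact hz⟩
  · exact he.attested_mem_hull hB (attested x B e he v hv y hy)
  · have h1 := attested x B e he v hv y hy
    have h2 := attested x B e he w hw z hz
    have hx' := fun v => hI (hx v)
    exact (abs_sub_le_iff.2 ⟨he.attested_dist hA hB hx' h1 h2,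
      he.attested_dist hA hB hx' h2 h1⟩).trans hε

lemma approxConsensusPossible_of_conditionA {V : Type u} [Fintype V] [DecidableEq V]
    {G : Digraph V} {f : ℕ} (hA : ConditionA G f) {I : Set ℝ} {a b : ℝ} (hI : I ⊆ Set.Icc a b)
    {ε : ℝ} (hε : 0 < ε) : ApproxConsensusPossible G f I ε := by
  obtain ⟨k, hk⟩ := pow_unbounded_of_one_lt ((b - a) / ε) one_lt_two
  refine ⟨_, blockAlgorithm_solves (k := k) hA hI ?_⟩
  rw [div_lt_iff₀ hε] at hk
  rw [div_le_iff₀ (by positivity)]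
  linarith

/-! ### Runs with a prescribed schedule -/

/-- The run `e` is driven by prescribed data: `act t` acts in step `t`, it receives the message
sent in step `s` if `plan t = some s` and such a message exists, a faulty actor sends `byz t`, and a
non-faulty one follows the algorithm. -/
structure Driven {V : Type u} [DecidableEq V] (G : Digraph V) (A : Algorithm V) (x : V → ℝ)
    (B : Finset V) (act : ℕ → V) (plan : ℕ → Option ℕ) (byz : ℕ → V → Option (Msg V))
    (e : Run V) : Prop where
  actor : e.actor = act
  recv : ∀ t s, e.recv t = some s ↔
    plan t = some s ∧ G.Adj (act s) (act t) ∧ ∃ m, e.sent s (act t) = some m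
  faulty : ∀ t, act t ∈ B → e.sent t = byz t
  follows : ∀ t, act t ∉ B → e.sent t = A.send (act t) (x (act t)) (e.view (act t) (t + 1))

open Classical in
/-- The views of all nodes just before step `t` together with the log of all messages sent. -/
noncomputable def drivenState {V : Type u} (G : Digraph V) (A : Algorithm V)
    (x : V → ℝ) (B : Finset V) (act : ℕ → V) (plan : ℕ → Option ℕ)
    (byz : ℕ → V → Option (Msg V)) : ℕ → (V → View V) × (ℕ → V → Option (Msg V))
  | 0 => (fun _ => [], fun _ _ => none)
  | t + 1 =>
    let p := drivenState G A x B act plan byz t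
    let o : Obs V := (plan t).bind fun s =>
      if G.Adj (act s) (act t) then (p.2 s (act t)).map fun m => (act s, m) else none
    let h : View V := o :: p.1 (act t)
    (Function.update p.1 (act t) h,
      Function.update p.2 t (if act t ∈ B then byz t else A.send (act t) (x (act t)) h))

lemma exists_driven {V : Type u} [DecidableEq V] (G : Digraph V) (A : Algorithm V) (x : V → ℝ)
    (B : Finset V) (act : ℕ → V) (plan : ℕ → Option ℕ) (hplan : ∀ t s, plan t = some s → s < t)
    (byz : ℕ → V → Option (Msg V)) : ∃ e, Driven G A x B act plan byz e := by
  classical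
  let D := drivenState G A x B act plan byz
  let sent : ℕ → V → Option (Msg V) := fun t => (D (t + 1)).2 t
  have log : ∀ s t, s < t → (D t).2 s = sent s := by
    intro s t hst
    induction t, hst using Nat.le_induction with
    | base => rfl
    | succ n hn ih =>
      rw [← ih]
      have : s ≠ n := by omega
      simp [D, drivenState, this]
  let e : Run V :=
    { actor := act
      recv := fun t => (plan t).bind fun s =>
        if G.Adj (act s) (act t) ∧ ∃ m, sent s (act t) = some m then some s else none
      sent := sent }
  have obs : ∀ t, e.obs t = (plan t).bind fun s =>
      if G.Adj (act s) (act t) then ((D t).2 s (act t)).map fun m => (act s, m) else none := by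
    intro t
    rcases hp : plan t with _ | s
    · simp [Run.obs, e, hp]
    · rw [Option.bind_some, log s t (hplan t s hp)]
      by_cases hadj : G.Adj (act s) (act t)
      · rcases hm : sent s (act t) with _ | m
        · simp [Run.obs, e, hp, hm]
        · simp [Run.obs, e, hp, hm, hadj]
      · simp [Run.obs, e, hp, hadj]
  have view : ∀ t v, e.view v t = (D t).1 v := by
    intro t
    induction t with
    | zero => intro v; rfl
    | succ t ih =>
      intro v
      by_cases hv : act t = v
      · subst hv
        have : e.view (act t) (t + 1) = e.obs t :: e.view (act t) t := by simp [Run.view, e]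
        rw [this, ih, obs]
        simp [D, drivenState]
      · have : e.view v (t + 1) = e.view v t := by simp [Run.view, e, hv]
        rw [this, ih]
        simp [D, drivenState, Ne.symm hv]
  refine ⟨e, rfl, fun t s => ?_, fun t ht => ?_, fun t ht => ?_⟩
  · simp only [e, Option.bind_eq_some_iff, Option.ite_none_right_eq_some, Option.some.injEq]
    constructor
    · rintro ⟨s', hs', h, rfl⟩
      exact ⟨hs', h⟩
    · rintro ⟨hs, h⟩
      exact ⟨s, hs, h, rfl⟩
  · simp [e, sent, D, drivenState, ht]
  · rw [view]
    simp [e, sent, D, drivenState, ht]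

/-- The message that the schedule `σ` proposes for step `t` may be delivered: it was sent earlier,
and the link is not blocked, blocking being in force only before time `T`. -/
def Deliverable {V : Type u} (σ : ℕ → V × ℕ) (blocked : V → V → Prop) (T t : ℕ) : Prop :=
  (σ t).2 < t ∧ (T ≤ t ∨ ¬ blocked (σ (σ t).2).1 (σ t).1)

open Classical in
/-- Node `(σ t).1` acts in step `t` and receives the message of step `(σ t).2` if this is the first
time that this message may be delivered to it. -/
noncomputable def deliveryPlan {V : Type u} (σ : ℕ → V × ℕ) (blocked : V → V → Prop) (T t : ℕ) :
    Option ℕ :=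
  if Deliverable σ blocked T t ∧ ∀ t' < t, σ t' = σ t → ¬ Deliverable σ blocked T t' then
    some (σ t).2 else none

section Schedule

variable {V : Type u} {σ : ℕ → V × ℕ} {blocked : V → V → Prop} {T : ℕ}

lemma deliveryPlan_eq_some {t s : ℕ} : deliveryPlan σ blocked T t = some s ↔
    (Deliverable σ blocked T t ∧ ∀ t' < t, σ t' = σ t → ¬ Deliverable σ blocked T t') ∧
      (σ t).2 = s := by
  simp [deliveryPlan]

lemma deliveryPlan_lt {t s : ℕ} (h : deliveryPlan σ blocked T t = some s) : s < t := by
  obtain ⟨⟨hd, -⟩, rfl⟩ := deliveryPlan_eq_some.1 h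
  exact hd.1

lemma deliveryPlan_injective {t t' s : ℕ} (h : deliveryPlan σ blocked T t = some s)
    (h' : deliveryPlan σ blocked T t' = some s) (hact : (σ t).1 = (σ t').1) : t = t' := by
  obtain ⟨⟨hd, hf⟩, hs⟩ := deliveryPlan_eq_some.1 h
  obtain ⟨⟨hd', hf'⟩, hs'⟩ := deliveryPlan_eq_some.1 h'
  have hσ : σ t = σ t' := Prod.ext hact (hs.trans hs'.symm)
  rcases lt_trichotomy t t' with hlt | heq | hgt
  · exact absurd hd (hf' t hlt hσ)
  · exact heq
  · exact absurd hd' (hf t' hgt hσ.symm)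

lemma exists_deliveryPlan_eq (hσ : ∀ p t, ∃ t', t ≤ t' ∧ σ t' = p) (v : V) (s : ℕ) :
    ∃ t, (σ t).1 = v ∧ deliveryPlan σ blocked T t = some s := by
  classical
  have hex : ∃ t, σ t = (v, s) ∧ Deliverable σ blocked T t := by
    obtain ⟨t, ht, hp⟩ := hσ (v, s) (max T (s + 1))
    refine ⟨t, hp, ?_, .inl ((le_max_left _ _).trans ht)⟩
    rw [hp]
    exact (le_max_right T (s + 1)).trans ht
  obtain ⟨hp, hd⟩ := Nat.find_spec hex
  refine ⟨Nat.find hex, by rw [hp], deliveryPlan_eq_some.2 ⟨⟨hd, fun t' ht' hσt hd' => ?_⟩, ?_⟩⟩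
  · exact Nat.find_min hex ht' ⟨hσt.trans hp, hd'⟩
  · rw [hp]

lemma deliveryPlan_of_blocked {t : ℕ} (ht : t < T) (h : blocked (σ (σ t).2).1 (σ t).1) :
    deliveryPlan σ blocked T t = none := by
  rw [deliveryPlan, if_neg]
  rintro ⟨⟨-, hT | hb⟩, -⟩
  · omega
  · exact hb h

/-- Blocking other links does not change the delivery times on a link. -/
lemma deliveryPlan_of_not_blocked {t : ℕ} (h : ¬ blocked (σ (σ t).2).1 (σ t).1) :
    deliveryPlan σ blocked T t = deliveryPlan σ (fun _ _ => False) 0 t := by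
  have hd : ∀ t', σ t' = σ t →
      (Deliverable σ blocked T t' ↔ Deliverable σ (fun _ _ => False) 0 t') := by
    intro t' ht'
    simp [Deliverable, ht', h]
  have : (Deliverable σ blocked T t ∧ ∀ t' < t, σ t' = σ t → ¬ Deliverable σ blocked T t') ↔
      (Deliverable σ (fun _ _ => False) 0 t ∧
        ∀ t' < t, σ t' = σ t → ¬ Deliverable σ (fun _ _ => False) 0 t') := by
    rw [hd t rfl]
    refine and_congr_right fun _ => forall_congr' fun t' => forall_congr' fun _ =>
      forall_congr' fun ht' => ?_
    rw [hd t' ht']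
  ext s
  rw [deliveryPlan_eq_some, deliveryPlan_eq_some, this]

lemma exists_schedule (V : Type u) [Countable V] [Nonempty V] :
    ∃ σ : ℕ → V × ℕ, ∀ p t, ∃ t', t ≤ t' ∧ σ t' = p := by
  obtain ⟨g, hg⟩ := exists_surjective_nat ((V × ℕ) × ℕ)
  refine ⟨fun t => (g t).1, fun p t => ?_⟩
  choose τ hτ using fun k : ℕ => hg (p, k)
  have hinj : Function.Injective τ := fun k k' h => by
    have := (hτ k).symm.trans ((congrArg g h).trans (hτ k'))
    exact (Prod.ext_iff.1 this).2
  obtain ⟨_, ⟨k, rfl⟩, hk⟩ := (Set.infinite_range_of_injective hinj).exists_gt t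
  exact ⟨τ k, hk.le, by simp [hτ]⟩

variable [DecidableEq V] {G : Digraph V} {A : Algorithm V} {x : V → ℝ} {B : Finset V}
  {byz : ℕ → V → Option (Msg V)} {e : Run V}

lemma Driven.isExecution
    (h : Driven G A x B (fun t => (σ t).1) (deliveryPlan σ blocked T) byz e)
    (hσ : ∀ p t, ∃ t', t ≤ t' ∧ σ t' = p)
    (hbyz : ∀ t, (σ t).1 ∈ B → ∀ w m, byz t w = some m →
      Derivable (B : Set V) (e.receivedBy B t) m) : IsExecution G A x B e := by
  have hact := h.actor
  refine ⟨fun t s hs => ?_, fun t t' s hs hs' ha => ?_, fun s v m _ hadj hm => ?_, fun v _ t => ?_,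
    fun t ht => ?_, fun t ht w m hm => ?_⟩
  · obtain ⟨hp, hr⟩ := (h.recv t s).1 hs
    rw [hact]
    exact ⟨deliveryPlan_lt hp, hr⟩
  · rw [hact] at ha
    exact deliveryPlan_injective ((h.recv t s).1 hs).1 ((h.recv t' s).1 hs').1 ha
  · rw [hact] at hadj ⊢
    obtain ⟨t, rfl, ht⟩ := exists_deliveryPlan_eq (blocked := blocked) (T := T) hσ v s
    exact ⟨t, rfl, (h.recv t s).2 ⟨ht, hadj, m, hm⟩⟩
  · obtain ⟨t', ht', hp⟩ := hσ (v, 0) t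
    exact ⟨t', ht', by rw [hact]; simp [hp]⟩
  · rw [hact] at ht ⊢
    exact h.follows t ht
  · rw [hact] at ht
    rw [h.faulty t ht] at hm
    exact hbyz t ht w m hm

/-- The run on schedule `σ`, without any blocking, in which the nodes in `F` stay silent. -/
abbrev SilentRun (G : Digraph V) (A : Algorithm V) (x : V → ℝ) (F : Finset V) (σ : ℕ → V × ℕ)
    (e : Run V) : Prop :=
  Driven G A x F (fun t => (σ t).1) (deliveryPlan σ (fun _ _ => False) 0) (fun _ _ => none) e

lemma exists_silentRun (G : Digraph V) (A : Algorithm V) (x : V → ℝ) (F : Finset V)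
    (σ : ℕ → V × ℕ) : ∃ e, SilentRun G A x F σ e :=
  exists_driven G A x F _ _ (fun _ _ => deliveryPlan_lt) _

lemma Driven.isExecution_of_silent (h : SilentRun G A x B σ e)
    (hσ : ∀ p t, ∃ t', t ≤ t' ∧ σ t' = p) : IsExecution G A x B e :=
  Driven.isExecution h hσ fun _ _ _ _ hm => by simp at hm

/-- In a run in which `F` is silent, a set closed in `G_F` receives messages only from itself. -/
lemma Driven.actor_mem_of_recv {F S : Finset V} (h : SilentRun G A x F σ e)
    (hS : InClosed G F S) {t s : ℕ} (ht : (σ t).1 ∈ S) (hs : e.recv t = some s) : (σ s).1 ∈ S := by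
  by_contra hcon
  obtain ⟨-, hadj, m, hm⟩ := (h.recv t s).1 hs
  rw [h.faulty s (hS.2 _ _ hadj ht hcon)] at hm
  simp at hm

end Schedule

/-! ### Simulating several worlds at once -/

/-- The faulty nodes `C` can make several worlds `W i` coexist up to time `T`. In `W i` the nodes
outside `S i` do not influence `S i`, because those with edges into `S i` are silent. If the sets
`S i` overlap only in `C`, then an execution with faulty set `C` exists in which every non-faulty
node of `S i` sees what it sees in `W i`: until `T`, all messages from outside `S i` to `S i` are
delayed, and the nodes of `C` send to `S i` what they send in `W i`. They can do so without forging
signatures, since in `W i` they act on messages that they also obtain in the simulation. -/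
lemma exists_simulation {V : Type u} [DecidableEq V] {G : Digraph V} {A : Algorithm V}
    {σ : ℕ → V × ℕ} (hσ : ∀ p t, ∃ t', t ≤ t' ∧ σ t' = p) {ι : Type*} {S F : ι → Finset V}
    {xs : ι → V → ℝ} {W : ι → Run V} (hW : ∀ i, SilentRun G A (xs i) (F i) σ (W i))
    (hS : ∀ i, InClosed G (F i) (S i)) {C : Finset V}
    (hC : ∀ i j v, v ∈ S i → v ∈ S j → v ∉ C → i = j) {x : V → ℝ}
    (hx : ∀ i, ∀ v ∈ S i, v ∉ C → x v = xs i v) (T : ℕ) :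
    ∃ e, IsExecution G A x C e ∧
      ∀ i, ∀ v ∈ S i, v ∉ C → ∀ t ≤ T, e.view v t = (W i).view v t := by
  classical
  let blocked : V → V → Prop := fun p v => ∃ i, v ∈ S i ∧ v ∉ C ∧ p ∉ S i
  let byz : ℕ → V → Option (Msg V) := fun t w =>
    if h : t < T ∧ ∃ i, (σ t).1 ∈ S i ∧ w ∈ S i then (W h.2.choose).sent t w else none
  have hbyz : ∀ t i w, t < T → (σ t).1 ∈ S i → w ∈ S i → w ∉ C → byz t w = (W i).sent t w := by
    intro t i w ht hp hw hwC
    have h : t < T ∧ ∃ i, (σ t).1 ∈ S i ∧ w ∈ S i := ⟨ht, i, hp, hw⟩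
    have hi : h.2.choose = i := hC _ _ w h.2.choose_spec.2 hw hwC
    simp only [byz, dif_pos h, hi]
  obtain ⟨e, he⟩ := exists_driven G A x C (fun t => (σ t).1) (deliveryPlan σ blocked T)
    (fun _ _ => deliveryPlan_lt) byz
  have eact : ∀ t, e.actor t = (σ t).1 := fun t => congrFun he.actor t
  have wact : ∀ i t, (W i).actor t = (σ t).1 := fun i t => congrFun (hW i).actor t
  let R : ℕ → Set (Msg V) := fun t => {m | ∃ s < t, (σ s).1 ∈ C ∧ ∃ p, e.obs s = some (p, m)}
  have R_mono : ∀ {t t'}, t ≤ t' → R t ⊆ R t' := fun h m ⟨s, hs, hm⟩ => ⟨s, hs.trans_le h, hm⟩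
  have key : ∀ t ≤ T, (∀ i, ∀ v ∈ S i, v ∉ C → e.view v t = (W i).view v t) ∧
      ∀ i, ∀ c ∈ S i, c ∈ C → ∀ p m, some (p, m) ∈ (W i).view c t →
        Derivable (C : Set V) (R t) m := by
    intro t
    induction t using Nat.strong_induction_on with
    | _ t ih =>
      rcases t with _ | t
      · intro _
        exact ⟨fun i v _ _ => rfl, fun i c _ _ p m hm => by simp [Run.view] at hm⟩
      intro ht
      -- messages of the non-faulty nodes of `S i` are the same in `e` and in `W i`
      have hsent : ∀ s < t, ∀ i, (σ s).1 ∈ S i → (σ s).1 ∉ C → e.sent s = (W i).sent s := by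
        intro s hs i hi hiC
        rw [he.follows s hiC, (hW i).follows s ((hS i).1 _ hi),
          (ih (s + 1) (by omega) (by omega)).1 i _ hi hiC, hx i _ hi hiC]
      obtain ⟨ih₁, ih₂⟩ := ih t (by omega) (by omega)
      constructor
      · intro i v hv hvC
        simp only [Run.view, eact, wact]
        split_ifs with hact
        · rw [ih₁ i v hv hvC]
          congr 1
          subst hact
          have hmsg : ∀ s < t, (σ s).1 ∈ S i → e.sent s (σ t).1 = (W i).sent s (σ t).1 := by
            intro s hs hsi
            by_cases hsC : (σ s).1 ∈ C
            · rw [he.faulty s hsC, hbyz s i _ (by omega) hsi hv hvC]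
            · rw [hsent s hs i hsi hsC]
          ext ⟨p, m⟩
          simp only [Run.obs_eq_some, eact, wact, he.recv, (hW i).recv]
          by_cases hb : blocked (σ (σ t).2).1 (σ t).1
          · have hout : (σ (σ t).2).1 ∉ S i := by
              obtain ⟨j, hj, -, hp⟩ := hb
              rwa [← hC i j _ hv hj hvC] at hp
            rw [deliveryPlan_of_blocked (by omega) hb]
            constructor
            · rintro ⟨s, ⟨h, -⟩, -⟩
              exact absurd h (by simp)
            · rintro ⟨s, hs, -⟩
              have hin := (hW i).actor_mem_of_recv (hS i) hv (((hW i).recv t s).2 hs)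
              rw [← (deliveryPlan_eq_some.1 hs.1).2] at hin
              exact absurd hin hout
          · rw [deliveryPlan_of_not_blocked hb]
            have hin : (σ (σ t).2).1 ∈ S i := by
              by_contra h
              exact hb ⟨i, hv, hvC, h⟩
            refine exists_congr fun s => ?_
            by_cases hs : deliveryPlan σ (fun _ _ => False) 0 t = some s
            · have h2 := (deliveryPlan_eq_some.1 hs).2
              rw [h2] at hin
              rw [hmsg s (deliveryPlan_lt hs) hin]
            · simp [hs]
        · exact ih₁ i v hv hvC
      · intro i c hc hcC p m hm
        have old : some (p, m) ∈ (W i).view c t →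
            Derivable (C : Set V) (R (t + 1)) m := fun h =>
          (ih₂ i c hc hcC p m h).trans subset_rfl fun m hm =>
            .received (R_mono (Nat.le_succ t) hm)
        simp only [Run.view, wact] at hm
        split_ifs at hm with hact
        swap
        · exact old hm
        rcases List.mem_cons.1 hm with hobs | hm
        swap
        · exact old hm
        subst hact
        obtain ⟨s, hs, rfl, hms⟩ := Run.obs_eq_some.1 hobs.symm
        have hin := (hW i).actor_mem_of_recv (hS i) hc hs
        obtain ⟨hplan, hadj, -⟩ := ((hW i).recv t s).1 hs
        have hst := deliveryPlan_lt hplan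
        rw [wact] at hms
        by_cases hsC : (σ s).1 ∈ C
        · -- a faulty sender: the message is made from what the senders have received in `W i`
          rw [(hW i).follows s ((hS i).1 _ hin)] at hms
          refine (A.authentic _ _ _ _ _ hms).trans (by simpa using hsC) ?_
          rintro m' ⟨p', hm'⟩
          exact ((ih (s + 1) (by omega) (by omega)).2 i _ hin hsC p' m' hm').trans subset_rfl
            fun m hm => .received (R_mono (by omega) hm)
        · -- a non-faulty sender: the message is received in `e` at the same time
          have hb : ¬ blocked (σ (σ t).2).1 (σ t).1 := fun ⟨_, _, h, _⟩ => h hcC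
          have hm' : e.sent s (σ t).1 = some m := by rw [hsent s hst i hin hsC]; exact hms
          refine .received ⟨t, Nat.lt_succ_self t, hcC, (σ s).1, ?_⟩
          refine Run.obs_eq_some.2 ⟨s, (he.recv t s).2 ⟨?_, hadj, m, hm'⟩, eact s, ?_⟩
          · rw [deliveryPlan_of_not_blocked hb]; exact hplan
          · rw [eact]; exact hm'
  refine ⟨e, he.isExecution hσ fun t ht w m hm => ?_,
    fun i v hv hvC t ht => (key t ht).1 i v hv hvC⟩
  simp only [byz] at hm
  split_ifs at hm with h
  have hi := h.2.choose_spec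
  rw [(hW _).follows t ((hS _).1 _ hi.1)] at hm
  refine (A.authentic _ _ _ _ _ hm).trans (by simpa using ht) ?_
  rintro m' ⟨p', hm'⟩
  refine ((key (t + 1) h.1).2 _ _ hi.1 ht p' m' hm').trans subset_rfl fun m hm => ?_
  obtain ⟨s, hs, hsC, hp⟩ := hm
  exact .received ⟨s, Nat.lt_succ_iff.1 hs, by rwa [eact], hp⟩

/-! ### Impossibility -/

section Impossibility

variable {V : Type u} [DecidableEq V] {G : Digraph V} {f : ℕ} {I : Set ℝ} {a b ε : ℝ}
  {A : Algorithm V}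

lemma Outputs.congr {x x' : V → ℝ} {e e' : Run V} {v : V} {y : ℝ} {t T : ℕ}
    (h : A.output v (x v) (e.view v t) = some y) (hx : x' v = x v) (ht : t ≤ T)
    (hview : ∀ t ≤ T, e'.view v t = e.view v t) : Outputs A x' e' v y :=
  ⟨t, by rw [hx, hview t ht]; exact h⟩

/-- If all non-faulty nodes have the same input, this is their output. -/
lemma SolvesApproxConsensus.output_eq (hA : SolvesApproxConsensus G f I ε A) {x : V → ℝ}
    {B : Finset V} {e : Run V} (hx : ∀ v, x v ∈ I) (hB : B.card ≤ f)
    (he : IsExecution G A x B e) {c : ℝ} (hc : ∀ v, v ∉ B → x v = c) {v : V} (hv : v ∉ B) {y : ℝ}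
    (hy : Outputs A x e v y) : y = c := by
  have h := hA.validity x B e hx hB he v hv y hy
  have hsub : x '' {w | w ∉ B} ⊆ {c} := by
    rintro _ ⟨w, hw, rfl⟩
    exact hc w hw
  exact convexHull_min hsub (convex_singleton c) h

/-- Let `S` be cut off by silent nodes, and let all nodes of `S` outside a small set `C` have the
input `c`. Then these nodes output `c`: for all they know, the nodes in `C` are faulty, and those
outside `S` are slow and have the input `c`, too. -/
lemma SolvesApproxConsensus.output_eq_of_silent (hA : SolvesApproxConsensus G f I ε A)
    {σ : ℕ → V × ℕ} (hσ : ∀ p t, ∃ t', t ≤ t' ∧ σ t' = p) {F S C : Finset V}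
    (hS : InClosed G F S) (hC : C.card ≤ f) {x : V → ℝ} {W : Run V} (hW : SilentRun G A x F σ W)
    {c : ℝ} (hc : c ∈ I) (hx : ∀ v ∈ S, v ∉ C → x v = c) {v : V} (hv : v ∈ S) (hvC : v ∉ C) {y : ℝ}
    (hy : Outputs A x W v y) : y = c := by
  obtain ⟨t, ht⟩ := hy
  obtain ⟨e, he, hview⟩ := exists_simulation (A := A) (C := C) (x := fun _ => c) hσ
    (ι := Unit) (S := fun _ => S) (F := fun _ => F) (xs := fun _ => x) (W := fun _ => W)
    (fun _ => hW) (fun _ => hS) (fun _ _ _ _ _ _ => rfl) (fun _ v hv hvC => (hx v hv hvC).symm) t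
  exact hA.output_eq (fun _ => hc) hC he (fun _ _ => rfl) hvC
    (Outputs.congr ht (hx v hv hvC).symm le_rfl (hview () v hv hvC))

/-- Two sets that can each be cut off by at most `f` silent nodes have more than `f` common nodes,
unless one contains the other: otherwise the common nodes, if faulty, can make the one set believe
that all inputs are `a` and the other one that all inputs are `b`. -/
lemma SolvesApproxConsensus.card_inter [Finite V] (hA : SolvesApproxConsensus G f I ε A)
    (ha : a ∈ I) (hb : b ∈ I) (hε : ε < b - a) {F F' S S' : Finset V} (hF : F.card ≤ f)
    (hF' : F'.card ≤ f) (hS : InClosed G F S) (hS' : InClosed G F' S') {v w : V} (hv : v ∈ S)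
    (hvS' : v ∉ S') (hw : w ∈ S') (hwS : w ∉ S) : f + 1 ≤ (S ∩ S').card := by
  by_contra hcon
  have hC : (S ∩ S').card ≤ f := by omega
  have : Nonempty V := ⟨v⟩
  obtain ⟨σ, hσ⟩ := exists_schedule V
  obtain ⟨W, hW⟩ := exists_silentRun G A (fun _ => a) F σ
  obtain ⟨W', hW'⟩ := exists_silentRun G A (fun _ => b) F' σ
  have eW := hW.isExecution_of_silent hσ
  have eW' := hW'.isExecution_of_silent hσ
  obtain ⟨y, t, hy⟩ := hA.termination _ F W (fun _ => ha) hF eW v (hS.1 v hv)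
  obtain ⟨z, t', hz⟩ := hA.termination _ F' W' (fun _ => hb) hF' eW' w (hS'.1 w hw)
  have hya : y = a := hA.output_eq (fun _ => ha) hF eW (fun _ _ => rfl) (hS.1 v hv) ⟨t, hy⟩
  rw [hya] at hy
  have hzb : z = b := hA.output_eq (fun _ => hb) hF' eW' (fun _ _ => rfl) (hS'.1 w hw) ⟨t', hz⟩
  rw [hzb] at hz
  let x : V → ℝ := fun u => if u ∈ S then a else b
  obtain ⟨e, he, hview⟩ := exists_simulation (A := A) (C := S ∩ S') (x := x) hσ
    (ι := Bool) (S := fun i => bif i then S else S') (F := fun i => bif i then F else F')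
    (xs := fun i _ => bif i then a else b) (W := fun i => bif i then W else W')
    (by rintro (_ | _) <;> assumption) (by rintro (_ | _) <;> assumption)
    (by
      rintro (_ | _) (_ | _) u hu hu' huC
      · rfl
      · exact absurd (Finset.mem_inter.2 ⟨hu', hu⟩) huC
      · exact absurd (Finset.mem_inter.2 ⟨hu, hu'⟩) huC
      · rfl)
    (by
      rintro (_ | _) u hu huC
      · have : u ∉ S := fun h => huC (Finset.mem_inter.2 ⟨h, hu⟩)
        simp [x, this]
      · have : u ∈ S := hu
        simp [x, this])
    (max t t')
  have hvC : v ∉ S ∩ S' := fun h => hvS' (Finset.mem_inter.1 h).2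
  have hwC : w ∉ S ∩ S' := fun h => hwS (Finset.mem_inter.1 h).1
  have hx : ∀ u, x u ∈ I := fun u => by
    by_cases hu : u ∈ S
    · simpa [x, hu] using ha
    · simpa [x, hu] using hb
  have h1 : Outputs A x e v a :=
    Outputs.congr (x := fun _ => a) (e := W) hy (by simp [x, hv]) (le_max_left t t')
      (hview true v hv hvC)
  have h2 : Outputs A x e w b :=
    Outputs.congr (x := fun _ => b) (e := W') hz (by simp [x, hwS]) (le_max_right t t')
      (hview false w hw hwC)
  have := hA.agreement x _ e hx hC he w v hwC hvC b a h2 h1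
  linarith [le_abs_self (b - a)]

/-- A set that can be cut off by at most `f` silent nodes does not split into two nonempty parts of
at most `f` nodes: with inputs `a` in one part and `b` in the other, each part would have to output
its own input, as the other part may be faulty. -/
lemma SolvesApproxConsensus.not_split [Finite V] (hA : SolvesApproxConsensus G f I ε A) (ha : a ∈ I)
    (hb : b ∈ I) (hε : ε < b - a) {F S P : Finset V} (hF : F.card ≤ f) (hS : InClosed G F S)
    (hP : P.card ≤ f) (hQ : (S \ P).card ≤ f) {v w : V} (hv : v ∈ S) (hvP : v ∈ P) (hw : w ∈ S)
    (hwP : w ∉ P) : False := by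
  have : Nonempty V := ⟨v⟩
  obtain ⟨σ, hσ⟩ := exists_schedule V
  let x : V → ℝ := fun u => if u ∈ P then a else b
  have hx : ∀ u, x u ∈ I := fun u => by
    by_cases hu : u ∈ P
    · simpa [x, hu] using ha
    · simpa [x, hu] using hb
  obtain ⟨W, hW⟩ := exists_silentRun G A x F σ
  have eW := hW.isExecution_of_silent hσ
  obtain ⟨y, hy⟩ := hA.termination _ F W hx hF eW v (hS.1 v hv)
  obtain ⟨z, hz⟩ := hA.termination _ F W hx hF eW w (hS.1 w hw)
  have h1 : y = a := hA.output_eq_of_silent hσ hS hQ hW ha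
    (fun u hu huC => by
      have : u ∈ P := by simpa [hu] using huC
      simp [x, this])
    hv (by simp [hvP]) hy
  have h2 : z = b := hA.output_eq_of_silent hσ hS hP hW hb (fun u _ hu => by simp [x, hu]) hw hwP hz
  have := hA.agreement x F W hx hF eW w v (hS.1 w hw) (hS.1 v hv) z y hz hy
  rw [h1, h2] at this
  linarith [le_abs_self (b - a)]

lemma conditionA_of_solves [Fintype V] (hn : f < Fintype.card V)
    (hA : SolvesApproxConsensus G f I ε A) (ha : a ∈ I) (hb : b ∈ I) (hε : ε < b - a) :
    ConditionA G f := by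
  -- a closed set with at most `f` nodes is disjoint from its complement, which it cuts off
  have large : ∀ F S : Finset V, F.card ≤ f → InClosed G F S → S.Nonempty → f + 1 ≤ S.card := by
    intro F S hF hS ⟨v, hv⟩
    by_contra hcon
    have hSf : S.card ≤ f := by omega
    obtain ⟨w, -, hw⟩ := exists_mem_notMem_of_card (S := Finset.univ) hn hSf
    have hcl : InClosed G S Sᶜ := ⟨fun u hu => Finset.mem_compl.1 hu,
      fun p q _ _ hp => by simpa using hp⟩
    have := hA.card_inter ha hb hε hF hSf hS hcl hv (by simpa using hv)
      (Finset.mem_compl.2 hw) hw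
    rw [Finset.inter_compl] at this
    simp at this
  have inter : ∀ F F' S S' : Finset V, F.card ≤ f → F'.card ≤ f → IsSourceComponent G F S →
      IsSourceComponent G F' S' → f + 1 ≤ (S ∩ S').card := by
    intro F F' S S' hF hF' hS hS'
    by_cases h1 : S ⊆ S'
    · rw [Finset.inter_eq_left.2 h1]
      exact large F S hF hS.inClosed hS.1.1
    by_cases h2 : S' ⊆ S
    · rw [Finset.inter_eq_right.2 h2]
      exact large F' S' hF' hS'.inClosed hS'.1.1
    obtain ⟨v, hv, hv'⟩ := Finset.not_subset.1 h1
    obtain ⟨w, hw, hw'⟩ := Finset.not_subset.1 h2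
    exact hA.card_inter ha hb hε hF hF' hS.inClosed hS'.inClosed hv hv' hw hw'
  refine ⟨fun F hF => ?_, fun F S hF hS => ?_, inter⟩
  · obtain ⟨v, -, hv⟩ := exists_mem_notMem_of_card (S := Finset.univ) hn hF
    obtain ⟨S, hS, -⟩ := exists_isSourceComponent_reach G F v hv
    refine ⟨S, hS, fun S' hS' => ?_⟩
    obtain ⟨c, hc⟩ := Finset.card_pos.1
      (lt_of_lt_of_le (Nat.succ_pos f) (inter F F S' S hF hF hS' hS))
    rw [Finset.mem_inter] at hc
    exact hS'.1.eq_of_mem hS.1 hc.1 hc.2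
  · by_contra hcon
    have hlarge := large F S hF hS.inClosed hS.1.1
    rcases Nat.eq_zero_or_pos f with rfl | hpos
    · omega
    obtain ⟨P, hPS, hP⟩ := Finset.exists_subset_card_eq (s := S) (n := f) (by omega)
    have hQ := Finset.card_sdiff_of_subset hPS
    obtain ⟨v, hv⟩ := Finset.card_pos.1 (hP ▸ hpos)
    obtain ⟨w, hw, hwP⟩ := exists_mem_notMem_of_card hlarge hP.le
    exact hA.not_split ha hb hε hF hS.inClosed hP.le (by omega) (hPS hv) hv hw hwP

end Impossibility

lemma approxConsensusPossible_iff {V : Type u} [Fintype V] [DecidableEq V] (G : Digraph V) {f : ℕ}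
    (hn : f < Fintype.card V) {I : Set ℝ} {a b : ℝ} (hab : a < b) (ha : a ∈ I) (hb : b ∈ I)
    (hI : I ⊆ Set.Icc a b) :
    (∀ ε : ℝ, 0 < ε → ApproxConsensusPossible G f I ε) ↔ ConditionA G f := by
  refine ⟨fun h => ?_, fun hA ε hε => approxConsensusPossible_of_conditionA hA hI hε⟩
  obtain ⟨A, hA⟩ := h ((b - a) / 2) (by linarith)
  exact conditionA_of_solves hn hA ha hb (by linarith)

theorem mainTheorem2 {V : Type*} [Fintype V] [DecidableEq V] (G : Digraph V) (f : ℕ)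
    (hf : 0 < f) (hn : f < Fintype.card V) :
    ((∀ ε : ℝ, 0 < ε → ApproxConsensusPossible G f {0, 1} ε) ↔ ConditionA G f) ∧
    (∀ a b : ℝ, a < b →
      ((∀ ε : ℝ, 0 < ε → ApproxConsensusPossible G f (Set.Icc a b) ε) ↔ ConditionA G f)) := by
  refine ⟨approxConsensusPossible_iff G hn zero_lt_one (by simp) (by simp) ?_, fun a b hab =>
    approxConsensusPossible_iff G hn hab (Set.left_mem_Icc.2 hab.le) (Set.right_mem_Icc.2 hab.le)
      subset_rfl⟩
  rintro x (rfl | rfl) <;> simp
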